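/- Let $\mathbb{F}_q$ be the finite field with $q$ elements and let $B$ be a finite semi-simple $\mathbb{F}_q$-algebra, written by Artin--Wedderburn as $$B \cong M_{d_1}(\mathbb{F}_{q^{n_1}}) \times \cdots \times M_{d_k}(\mathbb{F}_{q^{n_k}}),\qquad d_i, n_i\ge 1,$$ of dimension $n=\sum_{i=1}^k d_i^2 n_i \ge 2$ over $\mathbb{F}_q$, and put $m=\sum_{i=1}^k d_i n_i$. For $x=(x_1,\dots,x_k)\in B$ let $$\mathrm{Tr}_B(x)=\sum_{i=1}^k \mathrm{Tr}_{\mathbb{F}_{q^{n_i}}/\mathbb{F}_q}(\mathrm{tr}\,x_i),\qquad \mathrm{N}_B(x)=\prod_{i=1}^k \mathrm{N}_{\mathbb{F}_{q^{n_i}}/\mathbb{F}_q}(\det x_i)$$ be the (reduced) trace and norm. Let $\psi:\mathbb{F}_q\to\mathbb{C}^*$ be a non-trivial additive character. Then for every $b\in\mathbb{F}_q^*$, $$\sum_{\substack{x\in B^*\\ \mathrm{N}_B(x)=b}}\psi(\mathrm{Tr}_B(x)) \;=\; (-1)^{m-\sum_{i} d_i}\; q^{\frac{n-m}{2}} \sum_{\substack{y_1,\dots,y_m\in\mathbb{F}_q^*\\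 y_1\cdots y_m=b}}\psi(y_1+\cdots+y_m),$$ that is, $K_B(b)=(-1)^{m-\sum_i d_i}q^{(n-m)/2}K_{\mathbb{F}_q^m}(b)$. -/

import Mathlib

/-- The trace `∑ i, Tr_{K i / F} (tr (x i))` on an `F`-algebra `B` decomposed by `e` as a product of
matrix algebras over finite extensions `K i` of `F` (the reduced trace of `B` down to `F`). -/
noncomputable def ssTrace {F B : Type*} [Field F] [Ring B] [Algebra F B] {k : ℕ} {d : Fin k → ℕ}
    {K : Fin k → Type*} [∀ i, Field (K i)] [∀ i, Algebra F (K i)]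
    (e : B ≃ₐ[F] (∀ i, Matrix (Fin (d i)) (Fin (d i)) (K i))) (x : B) : F :=
  ∑ i, Algebra.trace F (K i) (Matrix.trace (e x i))

/-- The norm `∏ i, N_{K i / F} (det (x i))` on an `F`-algebra `B` decomposed by `e` as a product of
matrix algebras over finite extensions `K i` of `F` (the reduced norm of `B` down to `F`). -/
noncomputable def ssNorm {F B : Type*} [Field F] [Ring B] [Algebra F B] {k : ℕ} {d : Fin k → ℕ}
    {K : Fin k → Type*} [∀ i, Field (K i)] [∀ i, Algebra F (K i)]
    (e : B ≃ₐ[F] (∀ i, Matrix (Fin (d i)) (Fin (d i)) (K i))) (x : B) : F :=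
  ∏ i, Algebra.norm F (Matrix.det (e x i))

open Classical in
/-- The Kloosterman sum over `B`: the sum of `ψ (Tr_B x)` over the units `x` of `B` with
`N_B x = b`. -/
noncomputable def ssKloosterman {F B : Type*} [Field F] [Ring B] [Algebra F B] [Fintype B]
    {k : ℕ} {d : Fin k → ℕ}
    {K : Fin k → Type*} [∀ i, Field (K i)] [∀ i, Algebra F (K i)]
    (e : B ≃ₐ[F] (∀ i, Matrix (Fin (d i)) (Fin (d i)) (K i))) (ψ : AddChar F ℂ) (b : F) : ℂ :=
  ∑ x : B with IsUnit x ∧ ssNorm e x = b, ψ (ssTrace e x)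

open Classical in
/-- The classical hyper-Kloosterman sum: the sum of `ψ (y₁ + ⋯ + y_m)` over the
`y₁, …, y_m ∈ Fˣ` with `y₁ ⋯ y_m = b`. -/
noncomputable def hyperKloosterman {F : Type*} [Field F] [Fintype F] (ψ : AddChar F ℂ) (m : ℕ)
    (b : F) : ℂ :=
  ∑ y : Fin m → Fˣ with (∏ j, (y j : F)) = b, ψ (∑ j, (y j : F))

/-! Two functions on `Fˣ` agree once their sums against every multiplicative character `χ` agree.
Pairing the hyper-Kloosterman sum with `χ` gives `g ^ m`, where `g = gaussSum χ ψ`; pairing the sum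
over `B` gives `∑ χ(N x) ψ(Tr x)`, which factors over the simple components.

For `M_d(K)`, averaging over right translates by unipotent upper triangular matrices kills every
matrix that is not upper triangular. What is left is `|K| ^ (d(d-1)/2)` times the `d`-th power of a
Gauss sum over `K` (`sum_det_trace_eq`). The Hasse–Davenport relation (`hasse_davenport`) turns that
Gauss sum into `(-1) ^ ([K:F] - 1) * g ^ [K:F]`. Collecting powers gives the sign and the factor `q
^ ((n - m) / 2)`, both independent of `χ`. -/

/-! ### Gauss sums over matrix algebras -/

section MatrixGaussSum

variable {K : Type*} [Field K]

/-- The index set of the strictly upper triangular entries of a `d × d` matrix. -/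
abbrev UpperPairs (d : ℕ) : Type := {p : Fin d × Fin d // p.1 < p.2}

lemma two_mul_card_upperPairs_add (d : ℕ) :
    2 * Fintype.card (UpperPairs d) + d = d ^ 2 := by
  have h1 : Fintype.card (UpperPairs d) = Fintype.card {p : Fin d × Fin d // p.2 < p.1} :=
    Fintype.card_congr ((Equiv.prodComm _ _).subtypeEquiv (by simp))
  have h2 : d = Fintype.card {p : Fin d × Fin d // p.1 = p.2} := by
    conv_lhs => rw [← Fintype.card_fin d]
    exact Fintype.card_congr
      ⟨fun i => ⟨(i, i), rfl⟩, fun p => p.1.1, fun i => rfl, fun ⟨⟨a, b⟩, h⟩ => by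
        simp only at h; subst h; rfl⟩
  have h3 : d ^ 2 = Fintype.card (Fin d × Fin d) := by simp [sq]
  rw [h3]
  conv_lhs => rw [two_mul]; arg 1; arg 2; rw [h1]
  conv_lhs => arg 2; rw [h2]
  rw [Fintype.card_subtype, Fintype.card_subtype, Fintype.card_subtype, ← Finset.card_univ]
  rw [← Finset.card_union_of_disjoint, ← Finset.card_union_of_disjoint]
  · congr 1
    ext ⟨a, b⟩
    simp only [Finset.mem_union, Finset.mem_filter, Finset.mem_univ, true_and, iff_true]
    rcases lt_trichotomy a b with h | h | h <;> simp [h]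
  · rw [Finset.disjoint_left]
    rintro ⟨a, b⟩ h
    simp only [Finset.mem_union, Finset.mem_filter, Finset.mem_univ, true_and] at h ⊢
    rcases h with h | h
    · exact h.ne
    · exact h.ne'
  · rw [Finset.disjoint_left]
    rintro ⟨a, b⟩ h
    simp only [Finset.mem_filter, Finset.mem_univ, true_and] at h ⊢
    exact h.asymm

/-- The upper triangular matrix with diagonal `y` and strictly upper triangular entries `u`. -/
def upperMatrix {d : ℕ} (y : Fin d → K) (u : UpperPairs d → K) : Matrix (Fin d) (Fin d) K :=
  Matrix.of fun i j => if h : i < j then u ⟨(i, j), h⟩ else if i = j then y i else 0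

lemma upperMatrix_isUpperTriangular {d : ℕ} (y : Fin d → K) (u : UpperPairs d → K) :
    (upperMatrix y u).BlockTriangular id := by
  intro i j (h : j < i)
  simp [upperMatrix, h.asymm, h.ne']

lemma upperMatrix_diag {d : ℕ} (y : Fin d → K) (u : UpperPairs d → K) (i : Fin d) :
    upperMatrix y u i i = y i := by
  simp [upperMatrix]

lemma det_upperMatrix {d : ℕ} (y : Fin d → K) (u : UpperPairs d → K) :
    (upperMatrix y u).det = ∏ i, y i := by
  rw [Matrix.det_of_isUpperTriangular (upperMatrix_isUpperTriangular y u)]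
  simp [upperMatrix_diag]

lemma trace_upperMatrix {d : ℕ} (y : Fin d → K) (u : UpperPairs d → K) :
    (upperMatrix y u).trace = ∑ i, y i := by
  simp [Matrix.trace, upperMatrix_diag]

/-- Translating `M` by a unipotent matrix changes its trace by a linear form in `u` whose
coefficients are the entries of `M` below the diagonal. -/
lemma trace_mul_upperMatrix {d : ℕ} (M : Matrix (Fin d) (Fin d) K) (u : UpperPairs d → K) :
    (M * upperMatrix 1 u).trace = M.trace + ∑ p : UpperPairs d, M p.1.2 p.1.1 * u p := by
  have h1 : ∀ i j : Fin d, M j i * upperMatrix 1 u i j =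
      (if i = j then M j i else 0) + if h : i < j then M j i * u ⟨(i, j), h⟩ else 0 := by
    intro i j
    by_cases h : i < j
    · simp [upperMatrix, h, h.ne]
    · by_cases h' : i = j <;> simp [upperMatrix, h, h']
  have h2 : (M * upperMatrix 1 u).trace = ∑ i, ∑ j, M j i * upperMatrix 1 u i j := by
    simp only [Matrix.trace, Matrix.diag_apply, Matrix.mul_apply]
    rw [Finset.sum_comm]
  rw [h2]
  simp only [h1, Finset.sum_add_distrib]
  congr 1
  · simp [Matrix.trace]
  · rw [← Fintype.sum_prod_type',
      ← Fintype.sum_subtype_add_sum_subtype (fun p : Fin d × Fin d => p.1 < p.2)]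
    have hlt : ∀ p : {p : Fin d × Fin d // p.1 < p.2}, p.1.1 < p.1.2 := fun p => p.2
    have hnot : ∀ p : {p : Fin d × Fin d // ¬ p.1 < p.2}, ¬ p.1.1 < p.1.2 := fun p => p.2
    simp [hlt, hnot, -not_lt]

lemma AddChar.map_sum_eq_prod {A M ι : Type*} [AddCommMonoid A] [CommMonoid M] (ψ : AddChar A M)
    (s : Finset ι) (f : ι → A) : ψ (∑ i ∈ s, f i) = ∏ i ∈ s, ψ (f i) := by
  classical
  induction s using Finset.induction_on with
  | empty => simp
  | insert a s ha ih => simp [ha, ih, AddChar.map_add_eq_mul]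

variable [Fintype K]

lemma sum_addChar_linear {ι : Type*} [Fintype ι] [DecidableEq ι] {ψ : AddChar K ℂ} (hψ : ψ ≠ 1)
    (c : ι → K) [Decidable (c = 0)] :
    ∑ u : ι → K, ψ (∑ p, c p * u p) =
      if c = 0 then (Fintype.card K : ℂ) ^ Fintype.card ι else 0 := by
  classical
  have hprim := AddChar.IsPrimitive.of_ne_one hψ
  have h (a : K) : ∑ t : K, ψ (a * t) = if a = 0 then (Fintype.card K : ℂ) else 0 := by
    have := AddChar.sum_mulShift a hprim
    simpa [mul_comm] using this
  simp_rw [AddChar.map_sum_eq_prod]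
  rw [← Fintype.prod_sum (fun p t => ψ (c p * t))]
  simp_rw [h]
  split_ifs with hc
  · simp [hc]
  · obtain ⟨p, hp⟩ := Function.ne_iff.mp hc
    exact Finset.prod_eq_zero (Finset.mem_univ p) (if_neg hp)

/-- The Gauss sum of `χ ∘ det` over a matrix algebra. -/
theorem sum_det_trace_eq (χ : MulChar K ℂ) {ψ : AddChar K ℂ} (hψ : ψ ≠ 1) (d : ℕ) :
    ∑ M : Matrix (Fin d) (Fin d) K, χ M.det * ψ M.trace =
      (Fintype.card K : ℂ) ^ Fintype.card (UpperPairs d) * gaussSum χ ψ ^ d := by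
  classical
  have hq : (Fintype.card K : ℂ) ^ Fintype.card (UpperPairs d) ≠ 0 :=
    pow_ne_zero _ (by simp)
  -- Right translation by a unipotent matrix permutes all matrices and preserves the determinant.
  have hshift (u : UpperPairs d → K) :
      ∑ M : Matrix (Fin d) (Fin d) K, χ M.det * ψ M.trace =
        ∑ M : Matrix (Fin d) (Fin d) K,
          χ M.det * ψ M.trace * ψ (∑ p : UpperPairs d, M p.1.2 p.1.1 * u p) := by
    have hdet : (upperMatrix (1 : Fin d → K) u).det = 1 := by simp [det_upperMatrix]
    have hu : IsUnit (upperMatrix (1 : Fin d → K) u) := by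
      rw [Matrix.isUnit_iff_isUnit_det, hdet]; exact isUnit_one
    refine (Fintype.sum_bijective (fun M => M * upperMatrix 1 u)
      (IsUnit.isUnit_iff_mulRight_bijective.mp hu) _ _ fun M => ?_).symm
    rw [Matrix.det_mul, hdet, mul_one, trace_mul_upperMatrix, AddChar.map_add_eq_mul, mul_assoc]
  -- Averaging over `u`: orthogonality of `ψ` leaves only the `M` that vanish below the diagonal.
  have havg : (Fintype.card K : ℂ) ^ Fintype.card (UpperPairs d) *
      ∑ M : Matrix (Fin d) (Fin d) K, χ M.det * ψ M.trace =
      ∑ M : Matrix (Fin d) (Fin d) K with (fun p : UpperPairs d => M p.1.2 p.1.1) = 0,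
        χ M.det * ψ M.trace * (Fintype.card K : ℂ) ^ Fintype.card (UpperPairs d) := by
    have h1 : (Fintype.card K : ℂ) ^ Fintype.card (UpperPairs d) *
        ∑ M : Matrix (Fin d) (Fin d) K, χ M.det * ψ M.trace =
        ∑ _u : UpperPairs d → K, ∑ M : Matrix (Fin d) (Fin d) K, χ M.det * ψ M.trace := by
      rw [Finset.sum_const, Finset.card_univ, Fintype.card_fun, nsmul_eq_mul, Nat.cast_pow]
    rw [h1, Finset.sum_congr rfl fun u _ => hshift u, Finset.sum_comm, Finset.sum_filter]
    refine Finset.sum_congr rfl fun M _ => ?_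
    rw [← Finset.mul_sum, sum_addChar_linear hψ (fun p : UpperPairs d => M p.1.2 p.1.1)]
    split_ifs <;> simp
  have htri : ∑ M : Matrix (Fin d) (Fin d) K with (fun p : UpperPairs d => M p.1.2 p.1.1) = 0,
        χ M.det * ψ M.trace = ∑ w : (Fin d → K) × (UpperPairs d → K),
          ∏ i, χ (w.1 i) * ψ (w.1 i) := by
    symm
    refine Finset.sum_bij (fun w _ => upperMatrix w.1 w.2) (fun w _ => ?_) ?_ (fun M hM => ?_) ?_
    · simp only [Finset.mem_filter, Finset.mem_univ, true_and]
      ext p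
      exact upperMatrix_isUpperTriangular w.1 w.2 p.2
    · rintro ⟨y, u⟩ - ⟨y', u'⟩ - h
      refine Prod.ext (funext fun i => ?_) (funext fun p => ?_)
      · simpa [upperMatrix_diag] using congrFun (congrFun h i) i
      · simpa [upperMatrix, p.2] using congrFun (congrFun h p.1.1) p.1.2
    · simp only [Finset.mem_filter, Finset.mem_univ, true_and] at hM
      refine ⟨(fun i => M i i, fun p => M p.1.1 p.1.2), Finset.mem_univ _, ?_⟩
      ext i j
      rcases lt_trichotomy i j with h | rfl | h
      · simp [upperMatrix, h]
      · simp [upperMatrix]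
      · simpa [upperMatrix, h.asymm, h.ne'] using (congrFun hM ⟨(j, i), h⟩).symm
    · rintro ⟨y, u⟩ -
      rw [det_upperMatrix, trace_upperMatrix, map_prod, AddChar.map_sum_eq_prod,
        Finset.prod_mul_distrib]
  refine mul_left_cancel₀ hq ?_
  rw [havg, ← Finset.sum_mul, htri, mul_comm, Fintype.sum_prod_type]
  simp only [Finset.sum_const, Finset.card_univ, Fintype.card_fun, nsmul_eq_mul, Nat.cast_pow]
  rw [← Finset.mul_sum, ← Fintype.prod_sum (fun (_ : Fin d) t => χ t * ψ t)]
  simp [gaussSum]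

end MatrixGaussSum

/-! ### The Hasse–Davenport relation, via an L-series over `F[X]` -/

section HasseDavenport

open Polynomial UniqueFactorizationMonoid

variable {F : Type*} [Field F]

/-- The completely multiplicative weight on monic polynomials whose `L`-series is
`1 + gaussSum χ ψ * T`. -/
noncomputable def monicWeight (χ : MulChar F ℂ) (ψ : AddChar F ℂ) (f : F[X]) : ℂ :=
  χ ((-1) ^ f.natDegree * f.coeff 0) * ψ (-f.nextCoeff)

lemma monicWeight_one (χ : MulChar F ℂ) (ψ : AddChar F ℂ) : monicWeight χ ψ 1 = 1 := by
  simp [monicWeight, nextCoeff]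

lemma monicWeight_mul (χ : MulChar F ℂ) (ψ : AddChar F ℂ) {f g : F[X]} (hf : f.Monic)
    (hg : g.Monic) : monicWeight χ ψ (f * g) = monicWeight χ ψ f * monicWeight χ ψ g := by
  have h : (-1 : F) ^ (f.natDegree + g.natDegree) * (f.coeff 0 * g.coeff 0) =
      ((-1) ^ f.natDegree * f.coeff 0) * ((-1) ^ g.natDegree * g.coeff 0) := by ring
  rw [monicWeight, hf.natDegree_mul hg, hf.nextCoeff_mul hg, mul_coeff_zero, h, map_mul, neg_add,
    AddChar.map_add_eq_mul, monicWeight, monicWeight]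
  ring

lemma monicWeight_pow (χ : MulChar F ℂ) (ψ : AddChar F ℂ) {f : F[X]} (hf : f.Monic) (j : ℕ) :
    monicWeight χ ψ (f ^ j) = monicWeight χ ψ f ^ j := by
  induction j with
  | zero => simp [monicWeight_one]
  | succ j ih => rw [pow_succ, monicWeight_mul χ ψ (hf.pow j) hf, ih, pow_succ]

variable [Fintype F]

lemma finite_setOf_monic_natDegree_eq (n : ℕ) :
    {f : F[X] | f.Monic ∧ f.natDegree = n}.Finite := by
  have : Finite (degreeLT F n) := Finite.of_equiv _ (degreeLTEquiv F n).symm.toEquiv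
  exact Finite.of_equiv _ (monicEquivDegreeLT n).symm

variable (F) in
/-- The monic polynomials of degree `n`. -/
noncomputable def monicsOfDegree (n : ℕ) : Finset F[X] :=
  (finite_setOf_monic_natDegree_eq (F := F) n).toFinset

@[simp]
lemma mem_monicsOfDegree {n : ℕ} {f : F[X]} :
    f ∈ monicsOfDegree F n ↔ f.Monic ∧ f.natDegree = n := by
  simp [monicsOfDegree]

lemma sum_monicWeight_zero (χ : MulChar F ℂ) (ψ : AddChar F ℂ) :
    ∑ f ∈ monicsOfDegree F 0, monicWeight χ ψ f = 1 := by
  have : monicsOfDegree F 0 = {1} := by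
    ext f
    simp only [mem_monicsOfDegree, Finset.mem_singleton]
    exact ⟨fun h => h.1.natDegree_eq_zero.mp h.2, fun h => by simp [h]⟩
  rw [this, Finset.sum_singleton, monicWeight_one]

lemma sum_monicWeight_one (χ : MulChar F ℂ) (ψ : AddChar F ℂ) :
    ∑ f ∈ monicsOfDegree F 1, monicWeight χ ψ f = gaussSum χ ψ := by
  symm
  refine Finset.sum_bij (fun y _ => X - C y) (fun y _ => ?_) ?_ (fun f hf => ?_) (fun y _ => ?_)
  · simp [monic_X_sub_C]
  · intro y _ z _ h
    simpa using h
  · obtain ⟨hm, hd⟩ := mem_monicsOfDegree.mp hf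
    exact ⟨-f.coeff 0, Finset.mem_univ _, by
      rw [map_neg, sub_neg_eq_add]; exact (hm.eq_X_add_C hd).symm⟩
  · simp [monicWeight, nextCoeff_X_sub_C]

/-- Shifting the coefficient of `X ^ (n - 1)` by `-c` permutes the monics and multiplies each weight
by `ψ c ≠ 1`. The constant term is untouched because `n - 1 ≠ 0`. -/
lemma sum_monicWeight_eq_zero (χ : MulChar F ℂ) {ψ : AddChar F ℂ} (hψ : ψ ≠ 1) {n : ℕ}
    (hn : 2 ≤ n) : ∑ f ∈ monicsOfDegree F n, monicWeight χ ψ f = 0 := by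
  obtain ⟨c, hc⟩ := AddChar.ne_one_iff.mp hψ
  have hmem : ∀ (a : F) (f : F[X]), f ∈ monicsOfDegree F n →
      f + C a * X ^ (n - 1) ∈ monicsOfDegree F n := by
    intro a f hf
    obtain ⟨hm, hd⟩ := mem_monicsOfDegree.mp hf
    have hlt : (C a * X ^ (n - 1)).degree < f.degree := by
      rw [degree_eq_natDegree hm.ne_zero, hd]
      refine (degree_C_mul_X_pow_le _ _).trans_lt ?_
      exact_mod_cast (by omega : n - 1 < n)
    exact mem_monicsOfDegree.mpr
      ⟨hm.add_of_left hlt, by rw [natDegree_add_eq_left_of_degree_lt hlt, hd]⟩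
  have hshift : ∑ f ∈ monicsOfDegree F n, monicWeight χ ψ f =
      ∑ f ∈ monicsOfDegree F n, monicWeight χ ψ f * ψ c := by
    symm
    refine Finset.sum_bij' (fun f _ => f + C (-c) * X ^ (n - 1)) (fun f _ => f + C c * X ^ (n - 1))
      (fun f hf => hmem _ f hf) (fun f hf => hmem _ f hf) (fun f _ => ?_) (fun f _ => ?_)
      (fun f hf => ?_)
    · simp
    · simp
    · have h1 := mem_monicsOfDegree.mp hf
      have h2 := mem_monicsOfDegree.mp (hmem (-c) f hf)
      have hc0 : (f + C (-c) * X ^ (n - 1)).coeff 0 = f.coeff 0 := by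
        have : (0 : ℕ) ≠ n - 1 := by omega
        simp [coeff_X_pow, this]
      have hnext : (f + C (-c) * X ^ (n - 1)).nextCoeff = f.nextCoeff - c := by
        rw [nextCoeff_of_natDegree_pos (by omega), nextCoeff_of_natDegree_pos (by omega), h1.2,
          h2.2]
        simp [sub_eq_add_neg]
      rw [monicWeight, monicWeight, h1.2, h2.2, hc0, hnext, neg_sub, sub_eq_neg_add,
        AddChar.map_add_eq_mul, mul_assoc]
  rw [← Finset.sum_mul] at hshift
  by_contra h0
  exact hc (mul_left_cancel₀ h0 (by rw [← hshift, mul_one]))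

open Classical in
variable (F) in
/-- The monic irreducible polynomials of degree dividing `k`, for `k ≠ 0`. -/
noncomputable def irredsOfDegreeDvd (k : ℕ) : Finset F[X] :=
  (Finset.Icc 1 k).biUnion fun n => (monicsOfDegree F n).filter
    fun P => Irreducible P ∧ P.natDegree ∣ k

lemma mem_irredsOfDegreeDvd {k : ℕ} (hk : k ≠ 0) {P : F[X]} :
    P ∈ irredsOfDegreeDvd F k ↔ P.Monic ∧ Irreducible P ∧ P.natDegree ∣ k := by
  simp only [irredsOfDegreeDvd, Finset.mem_biUnion, Finset.mem_Icc, Finset.mem_filter,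
    mem_monicsOfDegree]
  constructor
  · rintro ⟨n, -, ⟨h1, -⟩, h2, h3⟩
    exact ⟨h1, h2, h3⟩
  · rintro ⟨h1, h2, h3⟩
    exact ⟨P.natDegree, ⟨h2.natDegree_pos, Nat.le_of_dvd (Nat.pos_of_ne_zero hk) h3⟩, ⟨h1, rfl⟩,
      h2, h3⟩

/-- The `k`-th power sum attached to the `L`-series of `monicWeight χ ψ`. -/
noncomputable def irredPowerSum (χ : MulChar F ℂ) (ψ : AddChar F ℂ) (k : ℕ) : ℂ :=
  ∑ P ∈ irredsOfDegreeDvd F k, (P.natDegree : ℂ) * monicWeight χ ψ P ^ (k / P.natDegree)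

open Classical in
lemma sum_monicWeight_of_dvd (χ : MulChar F ℂ) (ψ : AddChar F ℂ) {n : ℕ} {Q : F[X]}
    (hQ : Q.Monic) (hn : Q.natDegree ≤ n) :
    ∑ f ∈ monicsOfDegree F n with Q ∣ f, monicWeight χ ψ f =
      monicWeight χ ψ Q * ∑ h ∈ monicsOfDegree F (n - Q.natDegree), monicWeight χ ψ h := by
  rw [Finset.mul_sum]
  symm
  refine Finset.sum_bij (fun h _ => Q * h) (fun h hh => ?_) (fun h _ h' _ e => ?_)
    (fun f hf => ?_) (fun h hh => ?_)
  · obtain ⟨h1, h2⟩ := mem_monicsOfDegree.mp hh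
    simp only [Finset.mem_filter, mem_monicsOfDegree, dvd_mul_right, and_true]
    exact ⟨hQ.mul h1, by rw [hQ.natDegree_mul h1, h2]; omega⟩
  · exact mul_left_cancel₀ hQ.ne_zero e
  · simp only [Finset.mem_filter, mem_monicsOfDegree] at hf
    obtain ⟨⟨h1, h2⟩, h, rfl⟩ := hf
    have hh := hQ.of_mul_monic_left h1
    exact ⟨h, mem_monicsOfDegree.mpr ⟨hh, by rw [← h2, hQ.natDegree_mul hh]; omega⟩, rfl⟩
  · exact (monicWeight_mul χ ψ hQ (mem_monicsOfDegree.mp hh).1).symm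

open Classical in
-- Polynomial analogue of `log n = ∑_{d ∣ n} Λ(d)`: each prime power `P ^ j ∣ f` with `j ≥ 1`
-- contributes `deg P`, and is recorded at `k = j * deg P`.
lemma natDegree_eq_sum_irreds {f : F[X]} (hf : f.Monic) :
    f.natDegree = ∑ k ∈ Finset.Icc 1 f.natDegree, ∑ P ∈ irredsOfDegreeDvd F k,
      if P ^ (k / P.natDegree) ∣ f then P.natDegree else 0 := by
  set S := (normalizedFactors f).toFinset with hS
  have hmem (P : F[X]) : P ∈ S ↔ P.Monic ∧ Irreducible P ∧ P ∣ f := by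
    rw [hS, Multiset.mem_toFinset]
    constructor
    · intro h
      have hi := irreducible_of_normalized_factor P h
      exact ⟨(normalize_eq_self_iff_monic hi.ne_zero).mp (normalize_normalized_factor P h), hi,
        dvd_of_mem_normalizedFactors h⟩
    · rintro ⟨h1, h2, h3⟩
      exact (mem_normalizedFactors_iff' hf.ne_zero).mpr ⟨h2, h1.normalize_eq_self, h3⟩
  have hpow (P : F[X]) (hP : P ∈ S) (j : ℕ) :
      P ^ j ∣ f ↔ j ≤ (normalizedFactors f).count P := by
    obtain ⟨h1, h2, -⟩ := (hmem P).mp hP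
    rw [pow_dvd_iff_le_emultiplicity, emultiplicity_eq_count_normalizedFactors h2 hf.ne_zero,
      h1.normalize_eq_self, Nat.cast_le]
  have hinner : ∀ k ∈ Finset.Icc 1 f.natDegree,
      (∑ P ∈ irredsOfDegreeDvd F k, if P ^ (k / P.natDegree) ∣ f then P.natDegree else 0) =
        ∑ P ∈ S, if P.natDegree ∣ k ∧ P ^ (k / P.natDegree) ∣ f then P.natDegree else 0 := by
    intro k hk
    have hk1 := (Finset.mem_Icc.mp hk).1
    rw [← Finset.sum_filter, ← Finset.sum_filter]
    refine Finset.sum_congr ?_ fun _ _ => rfl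
    ext P
    simp only [Finset.mem_filter, mem_irredsOfDegreeDvd (by omega : k ≠ 0), hmem]
    constructor
    · rintro ⟨⟨h1, h2, h3⟩, h4⟩
      have : k / P.natDegree ≠ 0 :=
        (Nat.div_pos (Nat.le_of_dvd hk1 h3) h2.natDegree_pos).ne'
      exact ⟨⟨h1, h2, (dvd_pow_self P this).trans h4⟩, h3, h4⟩
    · rintro ⟨⟨h1, h2, -⟩, h3, h4⟩
      exact ⟨⟨h1, h2, h3⟩, h4⟩
  have hcount : ∀ P ∈ S, (∑ k ∈ Finset.Icc 1 f.natDegree,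
      if P.natDegree ∣ k ∧ P ^ (k / P.natDegree) ∣ f then P.natDegree else 0) =
        (normalizedFactors f).count P * P.natDegree := by
    intro P hP
    obtain ⟨h1, h2, -⟩ := (hmem P).mp hP
    have hd := h2.natDegree_pos
    rw [← Finset.sum_filter, Finset.sum_const, smul_eq_mul]
    congr 1
    have himage : {k ∈ Finset.Icc 1 f.natDegree | P.natDegree ∣ k ∧ P ^ (k / P.natDegree) ∣ f} =
        (Finset.Icc 1 ((normalizedFactors f).count P)).image (· * P.natDegree) := by
      ext k
      simp only [Finset.mem_filter, Finset.mem_Icc, Finset.mem_image]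
      constructor
      · rintro ⟨⟨hk1, -⟩, hdvd, hk⟩
        exact ⟨k / P.natDegree, ⟨Nat.div_pos (Nat.le_of_dvd hk1 hdvd) hd, (hpow P hP _).mp hk⟩,
          Nat.div_mul_cancel hdvd⟩
      · rintro ⟨j, ⟨hj1, hj⟩, rfl⟩
        have hj' := (hpow P hP j).mpr hj
        refine ⟨⟨Nat.mul_pos hj1 hd, ?_⟩, dvd_mul_left _ _, ?_⟩
        · rw [← natDegree_pow]
          exact natDegree_le_of_dvd hj' hf.ne_zero
        · rwa [Nat.mul_div_cancel _ hd]
    rw [himage, Finset.card_image_of_injective _ (mul_left_injective₀ hd.ne'), Nat.card_Icc,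
      Nat.add_sub_cancel]
  rw [Finset.sum_congr rfl hinner, Finset.sum_comm, Finset.sum_congr rfl hcount]
  have hprod : (normalizedFactors f).prod = f := by
    rw [prod_normalizedFactors_eq hf.ne_zero, hf.normalize_eq_self]
  conv_lhs => rw [← hprod]
  rw [natDegree_multiset_prod _ (zero_notMem_normalizedFactors f),
    Finset.sum_multiset_map_count]
  simp [hS]

/-- Logarithmic derivative of the Euler product, coefficient by coefficient: expand `n = deg f` over
prime powers dividing `f`, then use multiplicativity of the weight. -/
lemma newton_identity (χ : MulChar F ℂ) (ψ : AddChar F ℂ) (n : ℕ) :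
    (n : ℂ) * ∑ f ∈ monicsOfDegree F n, monicWeight χ ψ f =
      ∑ k ∈ Finset.Icc 1 n, irredPowerSum χ ψ k *
        ∑ f ∈ monicsOfDegree F (n - k), monicWeight χ ψ f := by
  classical
  have h1 : (n : ℂ) * ∑ f ∈ monicsOfDegree F n, monicWeight χ ψ f =
      ∑ f ∈ monicsOfDegree F n, ∑ k ∈ Finset.Icc 1 n, ∑ P ∈ irredsOfDegreeDvd F k,
        if P ^ (k / P.natDegree) ∣ f then (P.natDegree : ℂ) * monicWeight χ ψ f else 0 := by
    rw [Finset.mul_sum]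
    refine Finset.sum_congr rfl fun f hf => ?_
    obtain ⟨hm, hd⟩ := mem_monicsOfDegree.mp hf
    have := natDegree_eq_sum_irreds hm
    rw [hd] at this
    conv_lhs => rw [this]
    push_cast
    simp only [Finset.sum_mul, ite_mul, zero_mul]
  rw [h1, Finset.sum_comm]
  refine Finset.sum_congr rfl fun k hk => ?_
  have hk' := Finset.mem_Icc.mp hk
  rw [Finset.sum_comm, irredPowerSum, Finset.sum_mul]
  refine Finset.sum_congr rfl fun P hP => ?_
  obtain ⟨hm, -, hdvd⟩ := (mem_irredsOfDegreeDvd (by omega)).mp hP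
  have hdeg : (P ^ (k / P.natDegree)).natDegree = k := by
    rw [hm.natDegree_pow, Nat.div_mul_cancel hdvd]
  rw [← Finset.sum_filter, ← Finset.mul_sum,
    sum_monicWeight_of_dvd χ ψ (hm.pow _) (by rw [hdeg]; exact hk'.2), hdeg,
    monicWeight_pow χ ψ hm, mul_assoc]

lemma irredPowerSum_eq (χ : MulChar F ℂ) {ψ : AddChar F ℂ} (hψ : ψ ≠ 1) (k : ℕ) :
    irredPowerSum χ ψ (k + 1) = (-1) ^ k * gaussSum χ ψ ^ (k + 1) := by
  induction k with
  | zero =>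
    have := newton_identity χ ψ 1
    simpa [sum_monicWeight_zero, sum_monicWeight_one] using this.symm
  | succ k ih =>
    have h := newton_identity χ ψ (k + 1 + 1)
    -- The L-series is `1 + g T`, so only the top two indices survive, and each power sum is `-g`
    -- times the previous one.
    rw [sum_monicWeight_eq_zero χ hψ (by omega), mul_zero, Finset.sum_Icc_succ_top (by omega),
      Finset.sum_Icc_succ_top (by omega), Finset.sum_eq_zero, Nat.sub_self, sum_monicWeight_zero,
      Nat.add_sub_cancel_left, sum_monicWeight_one, ih] at h
    · linear_combination -h
    · intro j hj
      have := Finset.mem_Icc.mp hj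
      rw [sum_monicWeight_eq_zero χ hψ (by omega), mul_zero]

variable {K : Type*} [Field K] [Fintype K] [Algebra F K]

open Classical in
-- The degree condition makes `P` divide `X ^ |K| - X`, so `P` splits in `K`; it is separable, and
-- its roots are exactly the elements with minimal polynomial `P`.
lemma card_filter_minpoly_eq {P : F[X]} (hm : P.Monic) (hi : Irreducible P)
    (hdvd : P.natDegree ∣ Module.finrank F K) :
    (Finset.univ.filter fun x : K => minpoly F x = P).card = P.natDegree := by
  have hsplit : (P.map (algebraMap F K)).Splits := by
    have h1 := hi.natDegree_dvd_iff_dvd_X_pow_card_pow_sub_X.mp hdvd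
    have h2 : Nat.card F ^ Module.finrank F K = Fintype.card K := by
      rw [Nat.card_eq_fintype_card, Module.card_eq_pow_finrank (K := F) (V := K)]
    have h3 := Polynomial.map_dvd (algebraMap F K) h1
    rw [h2] at h3
    simp only [Polynomial.map_sub, Polynomial.map_pow, map_X] at h3
    refine Splits.of_dvd ?_ (FiniteField.X_pow_card_sub_X_ne_zero K Fintype.one_lt_card) h3
    rw [← Nat.card_eq_fintype_card]
    exact Polynomial.splits_X_pow_nat_card_sub_X
  have hsep : P.Separable := PerfectField.separable_of_irreducible hi
  rw [← card_rootSet_eq_natDegree hsep hsplit, ← Set.toFinset_card]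
  congr 1
  ext x
  simp only [Finset.mem_filter, Finset.mem_univ, true_and, Set.mem_toFinset,
    mem_rootSet_of_ne hm.ne_zero]
  exact ⟨fun h => h ▸ minpoly.aeval F x, fun h => (minpoly.eq_of_irreducible_of_monic hi h hm).symm⟩

/-- The exponent is `[K : F(x)]`. The norm and trace from `F(x)` are, up to sign, the constant and
next-to-leading coefficients of the minimal polynomial, which dictates the form of `monicWeight`. -/
lemma mulChar_norm_mul_addChar_trace {F K : Type*} [Field F] [Field K] [Algebra F K]
    [FiniteDimensional F K] (χ : MulChar F ℂ) (ψ : AddChar F ℂ) (x : K) :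
    χ (Algebra.norm F x) * ψ (Algebra.trace F K x) =
      monicWeight χ ψ (minpoly F x) ^ (Module.finrank F K / (minpoly F x).natDegree) := by
  have hx : IsIntegral F x := .of_finite F x
  have hfin : Module.finrank F K / (minpoly F x).natDegree =
      Module.finrank (IntermediateField.adjoin F {x}) K := by
    rw [← IntermediateField.adjoin.finrank hx,
      ← Module.finrank_mul_finrank F (IntermediateField.adjoin F {x}) K]
    exact Nat.mul_div_cancel_left _ Module.finrank_pos
  have hnorm : Algebra.norm F (IntermediateField.AdjoinSimple.gen F x) =
      (-1) ^ (minpoly F x).natDegree * (minpoly F x).coeff 0 := by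
    have := Algebra.PowerBasis.norm_gen_eq_coeff_zero_minpoly (IntermediateField.adjoin.powerBasis hx)
    simpa [IntermediateField.minpoly_gen] using this
  rw [hfin, Algebra.norm_eq_norm_adjoin, trace_eq_finrank_mul_minpoly_nextCoeff, hnorm, map_pow,
    monicWeight, mul_pow, ← nsmul_eq_mul, AddChar.map_nsmul_eq_pow]

lemma sum_norm_trace_eq_irredPowerSum (χ : MulChar F ℂ) (ψ : AddChar F ℂ) :
    ∑ x : K, χ (Algebra.norm F x) * ψ (Algebra.trace F K x) =
      irredPowerSum χ ψ (Module.finrank F K) := by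
  classical
  have hpos : Module.finrank F K ≠ 0 := Module.finrank_pos.ne'
  rw [irredPowerSum, ← Finset.sum_fiberwise_of_maps_to (s := Finset.univ)
    (t := irredsOfDegreeDvd F (Module.finrank F K)) (g := fun x : K => minpoly F x)]
  · refine Finset.sum_congr rfl fun P hP => ?_
    obtain ⟨hm, hi, hdvd⟩ := (mem_irredsOfDegreeDvd hpos).mp hP
    rw [Finset.sum_congr rfl (g := fun _ =>
      monicWeight χ ψ P ^ (Module.finrank F K / P.natDegree)), Finset.sum_const,
      card_filter_minpoly_eq hm hi hdvd, nsmul_eq_mul]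
    intro x hx
    rw [mulChar_norm_mul_addChar_trace, (Finset.mem_filter.mp hx).2]
  · intro x _
    have hx : IsIntegral F x := .of_finite F x
    exact (mem_irredsOfDegreeDvd hpos).mpr
      ⟨minpoly.monic hx, minpoly.irreducible hx, minpoly.degree_dvd hx⟩

/-- The Hasse–Davenport relation. -/
theorem hasse_davenport (χ : MulChar F ℂ) {ψ : AddChar F ℂ} (hψ : ψ ≠ 1) :
    ∑ x : K, χ (Algebra.norm F x) * ψ (Algebra.trace F K x) =
      (-1) ^ (Module.finrank F K - 1) * gaussSum χ ψ ^ Module.finrank F K := by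
  have hpos : 0 < Module.finrank F K := Module.finrank_pos
  obtain ⟨k, hk⟩ := Nat.exists_eq_succ_of_ne_zero hpos.ne'
  rw [sum_norm_trace_eq_irredPowerSum, hk, irredPowerSum_eq χ hψ, Nat.succ_sub_one]

end HasseDavenport

/-! ### Mellin transform on the multiplicative group -/

section MellinTransform

variable {F : Type*} [Field F] [Fintype F]

lemma MulChar.sum_apply_eq_zero [Fintype (MulChar F ℂ)] {a : F} (ha : a ≠ 1) :
    ∑ χ : MulChar F ℂ, χ a = 0 := by
  obtain ⟨χ, hχ⟩ := MulChar.exists_apply_ne_one_of_hasEnoughRootsOfUnity F ℂ ha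
  refine eq_zero_of_mul_eq_self_left hχ ?_
  simp only [Finset.mul_sum, ← MulChar.mul_apply]
  exact Fintype.sum_bijective _ (Group.mulLeft_bijective χ) _ _ fun χ' ↦ rfl

/-- Mellin inversion: weighting by `χ b⁻¹` and summing over `χ` isolates the value at `b`. Values at
`0` are invisible since `χ 0 = 0`. -/
lemma eq_of_forall_sum_mulChar_eq {f g : F → ℂ}
    (h : ∀ χ : MulChar F ℂ, ∑ b, χ b * f b = ∑ b, χ b * g b) {b : F} (hb : b ≠ 0) :
    f b = g b := by
  classical
  have : Fintype (MulChar F ℂ) := Fintype.ofFinite _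
  have key (f : F → ℂ) : ∑ χ : MulChar F ℂ, χ b⁻¹ * ∑ c, χ c * f c =
      Fintype.card (MulChar F ℂ) * f b := by
    simp_rw [Finset.mul_sum, ← mul_assoc, ← map_mul]
    rw [Finset.sum_comm]
    simp_rw [← Finset.sum_mul]
    rw [Finset.sum_eq_single b]
    · simp [inv_mul_cancel₀ hb]
    · intro c _ hc
      rw [MulChar.sum_apply_eq_zero, zero_mul]
      rwa [Ne, inv_mul_eq_one₀ hb, eq_comm]
    · simp
  have hcard : (Fintype.card (MulChar F ℂ) : ℂ) ≠ 0 := by simp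
  refine mul_left_cancel₀ hcard ?_
  rw [← key f, ← key g]
  simp_rw [h]

lemma sum_mulChar_mul_sum_filter {ι : Type*} (s : Finset ι) (χ : MulChar F ℂ)
    (N : ι → F) (φ : ι → ℂ) [∀ b, DecidablePred (N · = b)] :
    ∑ b, χ b * ∑ x ∈ s with N x = b, φ x = ∑ x ∈ s, χ (N x) * φ x := by
  simp_rw [Finset.mul_sum, Finset.sum_filter]
  rw [Finset.sum_comm]
  refine Finset.sum_congr rfl fun x _ => ?_
  rw [Fintype.sum_eq_single (N x) fun b hb => if_neg hb.symm, if_pos rfl]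

lemma sum_mulChar_mul_hyperKloosterman (χ : MulChar F ℂ) (ψ : AddChar F ℂ) (m : ℕ) :
    ∑ b, χ b * hyperKloosterman ψ m b = gaussSum χ ψ ^ m := by
  classical
  have hunits : gaussSum χ ψ = ∑ y : Fˣ, χ y * ψ y := by
    rw [gaussSum, ← Finset.sum_subset (Finset.subset_univ (Finset.univ.filter IsUnit))]
    · symm
      refine Finset.sum_bij (fun (y : Fˣ) _ => (y : F)) (by simp) (fun _ _ _ _ h => Units.ext h)
        (fun x hx => ?_) (fun _ _ => rfl)
      obtain ⟨u, rfl⟩ := (Finset.mem_filter.mp hx).2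
      exact ⟨u, Finset.mem_univ _, rfl⟩
    · intro x _ hx
      rw [MulChar.map_nonunit χ (by simpa using hx), zero_mul]
  simp only [hyperKloosterman]
  rw [sum_mulChar_mul_sum_filter Finset.univ χ (fun y : Fin m → Fˣ => ∏ j, (y j : F))]
  simp_rw [map_prod, AddChar.map_sum_eq_prod, ← Finset.prod_mul_distrib]
  rw [← Fintype.prod_sum (fun (_ : Fin m) (y : Fˣ) => χ y * ψ y), ← hunits]
  simp

/-- The multiplicative character `χ ∘ N` of an extension field. -/
noncomputable def MulChar.compNorm (χ : MulChar F ℂ) (K : Type*) [Field K] [Algebra F K]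
    [FiniteDimensional F K] : MulChar K ℂ where
  toMonoidHom := χ.toMonoidHom.comp (Algebra.norm F)
  map_nonunit' x hx := by
    have : x = 0 := by simpa using hx
    subst this
    exact χ.map_nonunit (by simp)

lemma sum_det_trace_norm_trace (χ : MulChar F ℂ) {ψ : AddChar F ℂ} (hψ : ψ ≠ 1)
    (K : Type*) [Field K] [Fintype K] [Algebra F K] (d : ℕ) :
    ∑ M : Matrix (Fin d) (Fin d) K,
        χ (Algebra.norm F M.det) * ψ (Algebra.trace F K M.trace) =
      (Fintype.card F : ℂ) ^ (Module.finrank F K * Fintype.card (UpperPairs d)) *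
        (-1) ^ (d * (Module.finrank F K - 1)) * gaussSum χ ψ ^ (d * Module.finrank F K) := by
  have hψ' : ψ.compAddMonoidHom (Algebra.trace F K).toAddMonoidHom ≠ 1 := by
    obtain ⟨c, hc⟩ := AddChar.ne_one_iff.mp hψ
    obtain ⟨x, rfl⟩ := Algebra.trace_surjective F K c
    exact AddChar.ne_one_iff.mpr ⟨x, hc⟩
  have h1 := sum_det_trace_eq (χ.compNorm K) hψ' d
  -- Unfolding the composed characters turns this Gauss sum into the sum of `hasse_davenport`.
  have h2 : gaussSum (χ.compNorm K) (ψ.compAddMonoidHom (Algebra.trace F K).toAddMonoidHom) =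
      (-1) ^ (Module.finrank F K - 1) * gaussSum χ ψ ^ Module.finrank F K :=
    hasse_davenport χ hψ
  rw [h2] at h1
  refine Eq.trans h1 ?_
  rw [Module.card_eq_pow_finrank (K := F) (V := K)]
  push_cast
  ring

end MellinTransform

/-! ### Semisimple algebras and the final comparison -/

section Semisimple

variable {F B : Type*} [Field F] [Ring B] [Algebra F B] {k : ℕ} {d : Fin k → ℕ}
  {K : Fin k → Type*} [∀ i, Field (K i)] [∀ i, Algebra F (K i)] [∀ i, FiniteDimensional F (K i)]

lemma isUnit_of_ssNorm_ne_zero (e : B ≃ₐ[F] (∀ i, Matrix (Fin (d i)) (Fin (d i)) (K i))) {x : B}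
    (hx : ssNorm e x ≠ 0) : IsUnit x := by
  rw [← MulEquiv.isUnit_map e, Pi.isUnit_iff]
  intro i
  rw [Matrix.isUnit_iff_isUnit_det, isUnit_iff_ne_zero]
  exact Algebra.norm_ne_zero_iff.mp (Finset.prod_ne_zero_iff.mp hx i (Finset.mem_univ i))

variable [Fintype F] [Fintype B]

lemma sum_mulChar_mul_ssKloosterman (e : B ≃ₐ[F] (∀ i, Matrix (Fin (d i)) (Fin (d i)) (K i)))
    (χ : MulChar F ℂ) (ψ : AddChar F ℂ) :
    ∑ b, χ b * ssKloosterman e ψ b = ∑ x : B, χ (ssNorm e x) * ψ (ssTrace e x) := by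
  classical
  rw [← sum_mulChar_mul_sum_filter Finset.univ χ (ssNorm e) fun x => ψ (ssTrace e x)]
  refine Finset.sum_congr rfl fun b _ => ?_
  -- The condition `IsUnit x` is automatic when `b ≠ 0`, and `χ 0 = 0` removes the remaining term.
  rcases eq_or_ne b 0 with rfl | hb
  · simp [MulChar.map_zero]
  · rw [ssKloosterman]
    congr 1
    refine Finset.sum_congr ?_ fun _ _ => rfl
    ext x
    simp only [Finset.mem_filter, Finset.mem_univ, true_and, and_iff_right_iff_imp]
    rintro rfl
    exact isUnit_of_ssNorm_ne_zero e hb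

lemma sum_ssNorm_ssTrace_eq (e : B ≃ₐ[F] (∀ i, Matrix (Fin (d i)) (Fin (d i)) (K i)))
    (χ : MulChar F ℂ) {ψ : AddChar F ℂ} (hψ : ψ ≠ 1) :
    ∑ x : B, χ (ssNorm e x) * ψ (ssTrace e x) =
      (Fintype.card F : ℂ) ^ (∑ i, Module.finrank F (K i) * Fintype.card (UpperPairs (d i))) *
        (-1) ^ (∑ i, d i * (Module.finrank F (K i) - 1)) *
          gaussSum χ ψ ^ (∑ i, d i * Module.finrank F (K i)) := by
  classical
  have (i : Fin k) : Finite (K i) := Module.finite_of_finite F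
  have (i : Fin k) : Fintype (K i) := Fintype.ofFinite _
  rw [Fintype.sum_equiv e.toEquiv _ (fun y : ∀ i, Matrix (Fin (d i)) (Fin (d i)) (K i) =>
    ∏ i, χ (Algebra.norm F (y i).det) * ψ (Algebra.trace F (K i) (y i).trace))]
  · rw [← Fintype.prod_sum (fun i (M : Matrix (Fin (d i)) (Fin (d i)) (K i)) =>
      χ (Algebra.norm F M.det) * ψ (Algebra.trace F (K i) M.trace))]
    simp_rw [sum_det_trace_norm_trace χ hψ, Finset.prod_mul_distrib, Finset.prod_pow_eq_pow_sum]
  · intro x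
    rw [ssNorm, ssTrace, map_prod, AddChar.map_sum_eq_prod, ← Finset.prod_mul_distrib]
    rfl

end Semisimple

theorem lemma3p1 {F B : Type*} [Field F] [Fintype F] [Ring B] [Algebra F B] [Fintype B]
    {k : ℕ} (d : Fin k → ℕ) (hd : ∀ i, 1 ≤ d i)
    (K : Fin k → Type*) [∀ i, Field (K i)] [∀ i, Algebra F (K i)]
    [∀ i, FiniteDimensional F (K i)]
    (e : B ≃ₐ[F] (∀ i, Matrix (Fin (d i)) (Fin (d i)) (K i)))
    (n m : ℕ) (hn : n = ∑ i, d i ^ 2 * Module.finrank F (K i))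
    (hm : m = ∑ i, d i * Module.finrank F (K i)) (hn2 : 2 ≤ n)
    (ψ : AddChar F ℂ) (hψ : ψ ≠ 1) (b : F) (hb : b ≠ 0) :
    ssKloosterman e ψ b =
      (-1 : ℂ) ^ ((m : ℤ) - ∑ i, (d i : ℤ)) *
        (((Fintype.card F : ℝ) ^ (((n : ℝ) - (m : ℝ)) / 2) : ℝ) : ℂ) *
        hyperKloosterman ψ m b := by
  -- `t = ∑ n_i d_i (d_i - 1) / 2`, which makes `(n - m) / 2` a natural number.
  set t := ∑ i, Module.finrank F (K i) * Fintype.card (UpperPairs (d i)) with ht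
  have hsign : (m : ℤ) - ∑ i, (d i : ℤ) =
      ((∑ i, d i * (Module.finrank F (K i) - 1) : ℕ) : ℤ) := by
    rw [hm]
    push_cast
    rw [← Finset.sum_sub_distrib]
    refine Finset.sum_congr rfl fun i _ => ?_
    rw [Nat.cast_sub Module.finrank_pos]
    push_cast
    ring
  have hexp : ((n : ℝ) - (m : ℝ)) / 2 = (t : ℝ) := by
    have : n = 2 * t + m := by
      rw [hn, hm, ht, Finset.mul_sum, ← Finset.sum_add_distrib]
      refine Finset.sum_congr rfl fun i _ => ?_
      rw [← two_mul_card_upperPairs_add]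
      ring
    rw [this]
    push_cast
    ring
  rw [hsign, hexp, zpow_natCast, Real.rpow_natCast]
  push_cast
  refine eq_of_forall_sum_mulChar_eq (f := ssKloosterman e ψ) (g := fun c =>
    (-1 : ℂ) ^ (∑ i, d i * (Module.finrank F (K i) - 1)) * (Fintype.card F : ℂ) ^ t *
      hyperKloosterman ψ m c) (fun χ => ?_) hb
  simp_rw [mul_left_comm (χ _)]
  rw [← Finset.mul_sum, sum_mulChar_mul_hyperKloosterman, sum_mulChar_mul_ssKloosterman,
    sum_ssNorm_ssTrace_eq e χ hψ, ← hm, mul_comm (_ ^ t)]
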